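/- Let $V$ be a real inner product space and $\Phi\subset V$ an irreducible (finite, reduced, crystallographic) root system whose reflections are orthogonal transformations of $V$. Fix a simple system $\Delta=\{\alpha_1,\dots,\alpha_\ell\}$ with set of positive roots $\Phi^+$. The height of $\alpha=\sum_i c_i\alpha_i\in\Phi^+$ is $\mathrm{Ht}(\alpha)=\sum_i c_i$, and $H_\alpha\subset V$ is the hyperplane orthogonal to $\alpha$. For $\alpha,\beta\in\Phi^+$ write $\alpha\ge\beta$ if $\alpha-\beta\in\mathbb{Z}_{\ge0}\alpha_1+\cdots+\mathbb{Z}_{\ge0}\alpha_\ell$. A subset $I\subseteq\Phi^+$ is an ideal if every $\beta\in\Phi^+$ with $\beta\le\alpha$ for some $\alpha\in I$ belongs to $I$. For an arrangement $\mathcal{A}$ of hyperplanes and a subspace $X$ of $V$, the restriction of $\mathcal{A}$ to $X$ is $\mathcal{A}^X=\{H\cap X\mid H\in\mathcal{A},\ X\not\subseteq H\}$. Let $I\subseteq\Phi^+$ be an ideal, and let $\alpha\in I$ with $k+1:=\mathrm{Ht}(\alpha)>1$. Define $$\mathcal{B}'=\{H_\beta\mid\beta\in I,\ \mathrm{Ht}(\beta)\le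 k\},\qquad \mathcal{B}=\mathcal{B}'\cup\{H_\alpha\},\qquad \mathcal{B}''=\mathcal{B}^{H_\alpha}.$$ Then $\mathcal{B}''=\{H\cap H_\alpha\mid H\in\mathcal{B}'\}$ and $$|\mathcal{B}'|-|\mathcal{B}''|=k.$$ -/

import Mathlib

open scoped InnerProductSpace

namespace IdealArrangement

variable {ι V N : Type*} [NormedAddCommGroup V] [InnerProductSpace ℝ V]
  [AddCommGroup N] [Module ℝ N]

/-- The root poset order relative to a simple system: `RootLE b i j` says that
`α_j - α_i` is a combination of simple roots with non-negative integer coefficients. -/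
def RootLE {P : RootPairing ι ℝ V N} (b : P.Base) (i j : ι) : Prop :=
  P.root j - P.root i ∈ AddSubmonoid.closure (P.root '' (b.support : Set ι))

/-- An ideal of the root poset: a set of (indices of) positive roots which, with each of its
members, contains every smaller positive root. -/
structure IsRootIdeal {P : RootPairing ι ℝ V N} (b : P.Base) (I : Set ι) : Prop where
  isPos : ∀ i ∈ I, b.IsPos i
  mem_of_le : ∀ i ∈ I, ∀ j, b.IsPos j → RootLE b j i → j ∈ I

/-- The hyperplane of `V` orthogonal to the root with index `i`. -/
noncomputable def rootHyperplane (P : RootPairing ι ℝ V N) (i : ι) : Submodule ℝ V :=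
  (Submodule.span ℝ {P.root i})ᗮ

/-- The hyperplanes orthogonal to those roots in `I` whose height is at most `k`. -/
def heightArrangement {P : RootPairing ι ℝ V N} (b : P.Base) (I : Set ι) (k : ℕ) :
    Set (Submodule ℝ V) :=
  {H | ∃ i ∈ I, b.height i ≤ (k : ℤ) ∧ H = rootHyperplane P i}

/-- The restriction of an arrangement `A` to a subspace `X`: all `H ∩ X` with `H ∈ A` not
containing `X`. -/
def restriction (A : Set (Submodule ℝ V)) (X : Submodule ℝ V) : Set (Submodule ℝ V) :=
  {Y | ∃ H ∈ A, ¬ X ≤ H ∧ Y = H ⊓ X}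

end IdealArrangement

/-! Taking orthogonal complements turns the claim into a count of planes: if `F` is the set of roots
in `I` of height at most `k`, then |B'| = |F|, while |B''| is the number of planes spanned by `α`
and a member of `F`.

The pairings of `α` with all positive coroots sum to 2 Ht(α) (`sum_pairingIn_isPos`). The term of
`α` is 2, so the other positive roots contribute 2k. Group these by the plane they span with `α`.
Each plane carries a rank two root system, and the same identity there gives 2(h - 1), with h the
height of `α` inside the plane. If h > 1, the plane contains exactly h positive roots lower than
`α`, all below it in the root poset and hence in `I` (`IsPos.sub_mem_closure_and_ncard_eq_height`).
If h = 1, at most one root of the plane is lower. Either way a plane that meets `F` in t ≥ 1 roots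
contributes 2(t - 1), and the other planes contribute 0. Summing gives k = |F| - #planes. -/

namespace RootPairing

variable {ι R M N : Type*} [CommRing R] [CharZero R] [AddCommGroup M] [Module R M]
  [AddCommGroup N] [Module R N] {P : RootPairing ι R M N}

/-! ### Positive roots, heights and the sum of positive coroots. -/

namespace Base

variable {b : P.Base}

/-- A positive root is a combination of simple roots with natural number coefficients. -/
lemma IsPos.exists_root_eq_sum_nat {i : ι} (hi : b.IsPos i) :
    ∃ f : ι → ℕ, P.root i = ∑ j ∈ b.support, f j • P.root j := by
  obtain ⟨f, -, hf | hf⟩ := b.exists_root_eq_sum_nat_or_neg i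
  · exact ⟨f, hf⟩
  · have h : P.root i = ∑ j ∈ b.support, (-(f j : ℤ)) • P.root j := by
      simp [hf]
    rw [isPos_iff, height_eq_sum h, Finset.sum_neg_distrib] at hi
    have : 0 ≤ ∑ j ∈ b.support, (f j : ℤ) := Finset.sum_nonneg fun _ _ ↦ by positivity
    lia

lemma IsPos.root_mem_closure {i : ι} (hi : b.IsPos i) :
    P.root i ∈ AddSubmonoid.closure (P.root '' b.support) := by
  obtain ⟨f, hf⟩ := hi.exists_root_eq_sum_nat
  rw [hf]
  exact sum_mem fun j hj ↦
    AddSubmonoid.nsmul_mem _ (AddSubmonoid.subset_closure (Set.mem_image_of_mem _ hj)) _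

lemma IsPos.root_ne_neg {i j : ι} (hi : b.IsPos i) (hj : b.IsPos j) : P.root i ≠ -P.root j := by
  intro h
  rw [root_eq_neg_iff] at h
  subst h
  exact (IsPos.neg_iff_not b j).mp hi hj

lemma IsPos.linearIndependent [P.IsReduced] {i j : ι} (hi : b.IsPos i) (hj : b.IsPos j)
    (hij : i ≠ j) : LinearIndependent R ![P.root i, P.root j] :=
  IsReduced.linearIndependent P hij (hi.root_ne_neg hj)

/-- The height extends to a linear functional. -/
lemma exists_linearMap_apply_root_eq_height [P.IsRootSystem] (b : P.Base) :
    ∃ H : M →ₗ[R] R, ∀ i, H (P.root i) = b.height i := by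
  refine ⟨b.toWeightBasis.constr R fun _ ↦ (1 : R), fun i ↦ ?_⟩
  obtain ⟨f, -, -, hf⟩ := b.exists_root_eq_sum_int i
  rw [height_eq_sum hf, hf, map_sum, Int.cast_sum]
  refine Finset.sum_congr rfl fun j hj ↦ ?_
  rw [map_zsmul, ← b.toWeightBasis_apply ⟨j, hj⟩, Module.Basis.constr_basis]
  simp

section

variable [Finite ι] [IsDomain R] [P.IsCrystallographic] [P.IsReduced]

/-- The positive coroots sum to an element on which every root takes twice its height. -/
lemma sum_pairingIn_isPos [Fintype ι] [DecidablePred b.IsPos] (i : ι) :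
    ∑ j with b.IsPos j, P.pairingIn ℤ i j = 2 * b.height i := by
  classical
  have simple : ∀ l ∈ b.support, ∑ j with b.IsPos j, P.pairingIn ℤ l j = 2 := by
    intro l hl
    have hlpos : l ∈ Finset.univ.filter b.IsPos := by simpa using isPos_of_mem_support hl
    rw [← Finset.add_sum_erase _ _ hlpos, pairingIn_same, add_eq_left]
    -- A simple reflection permutes the positive roots other than its own. It also negates their
    -- pairings with the simple root, so the remaining sum equals its own negative.
    have key : ∀ j ∈ (Finset.univ.filter b.IsPos).erase l,
        P.reflectionPerm l j ∈ (Finset.univ.filter b.IsPos).erase l := by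
      intro j hj
      simp only [Finset.mem_erase, Finset.mem_filter, Finset.mem_univ, true_and] at hj ⊢
      refine ⟨fun h ↦ ?_, hj.2.reflectionPerm hl hj.1⟩
      have h' : j = P.reflectionPerm l l := by simpa [h] using (P.reflectionPerm_self l j).symm
      have := hj.2
      have h2 := b.height_reflectionPerm_self l
      have h3 := isPos_of_mem_support hl
      rw [isPos_iff] at this h3
      rw [h'] at this
      change b.height (P.reflectionPerm l l) = _ at h2
      lia
    have := Finset.sum_bij' (s := (Finset.univ.filter b.IsPos).erase l)
      (t := (Finset.univ.filter b.IsPos).erase l) (f := fun j ↦ P.pairingIn ℤ l j)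
      (g := fun j ↦ - P.pairingIn ℤ l j)
      (fun j _ ↦ P.reflectionPerm l j) (fun j _ ↦ P.reflectionPerm l j) key key
      (fun j _ ↦ P.reflectionPerm_self l j) (fun j _ ↦ P.reflectionPerm_self l j)
      (fun j _ ↦ by rw [pairingIn_reflectionPerm, pairingIn_reflectionPerm_self_left, neg_neg])
    rw [Finset.sum_neg_distrib] at this
    lia
  obtain ⟨f, -, -, hf⟩ := b.exists_root_eq_sum_int i
  have expand (j : ι) : P.pairingIn ℤ i j = ∑ l ∈ b.support, f l * P.pairingIn ℤ l j :=
    FaithfulSMul.algebraMap_injective ℤ R <| by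
      simp_rw [algebraMap_pairingIn, map_sum, map_mul, algebraMap_pairingIn,
        ← root_coroot_eq_pairing, hf, map_sum, map_zsmul,
        LinearMap.coe_sum, Finset.sum_apply, LinearMap.smul_apply, root_coroot_eq_pairing,
        zsmul_eq_mul, eq_intCast]
  simp_rw [expand]
  rw [Finset.sum_comm, height_eq_sum hf, Finset.mul_sum]
  refine Finset.sum_congr rfl fun l hl ↦ ?_
  rw [← Finset.mul_sum, simple l hl, mul_comm]

end

end Base

/-! ### Bases from linear functionals. -/

section Existence

variable {K V W : Type*} [Field K] [LinearOrder K] [IsStrictOrderedRing K]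
  [AddCommGroup V] [Module K V] [AddCommGroup W] [Module K W] [Finite ι]

/-- A linear functional which vanishes on no root determines a base whose positive roots are those
on which the functional is positive. -/
lemma exists_base_forall_isPos_iff (P : RootPairing ι K V W) [P.IsRootSystem]
    [P.IsCrystallographic] [P.IsReduced] (f : Module.Dual K V) (hf : ∀ i, f (P.root i) ≠ 0) :
    ∃ b : P.Base, ∀ i, b.IsPos i ↔ 0 < f (P.root i) := by
  let := P.indexNeg
  let s := IsAddIndecomposable.baseOf P.root (f : V →+ K)
  let b : P.Base := Base.mk' P s (P.linearIndepOn_root_baseOf' f hf)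
    fun i ↦ IsAddIndecomposable.mem_or_neg_mem_closure_baseOf P.root (f : V →+ K) i (hf i) (by simp)
  have pos : ∀ i, b.IsPos i → 0 < f (P.root i) := by
    intro i hi
    obtain ⟨g, hg⟩ := hi.exists_root_eq_sum_nat
    refine lt_of_le_of_ne ?_ (hf i).symm
    rw [hg, map_sum]
    refine Finset.sum_nonneg fun j hj ↦ ?_
    rw [map_nsmul]
    have : j ∈ s := by simpa [b, Base.mk'] using hj
    exact nsmul_nonneg (le_of_lt this.1) _
  refine ⟨b, fun i ↦ ⟨pos i, fun h ↦ ?_⟩⟩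
  refine (Base.IsPos.or_neg b i).resolve_right fun hn ↦ ?_
  have := pos _ hn
  simp only [indexNeg_neg, root_reflectionPerm, reflection_apply_self, map_neg] at this
  linarith

end Existence

end RootPairing

/-! ### Rank two root systems. -/

/-- A finite set of coordinate vectors in which every vector of coordinate sum `h > 1` dominates
all vectors of at most the same coordinate sum, and there are `h` vectors of smaller sum. -/
def IsGradedChain (L : Finset (ℤ × ℤ)) : Prop :=
  ∀ p ∈ L, 1 < p.1 + p.2 → ((L.filter fun q ↦ q.1 + q.2 < p.1 + p.2).card : ℤ) = p.1 + p.2 ∧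
    ∀ q ∈ L, q.1 + q.2 ≤ p.1 + p.2 → q.1 ≤ p.1 ∧ q.2 ≤ p.2

/-- The coordinates of the positive roots of a rank two root system. -/
lemma exists_isGradedChain (R : ℤ → ℤ → Prop) {m n : ℤ}
    (hmn : m = 0 ∧ n = 0 ∨ n = 1 ∧ (m = 1 ∨ m = 2 ∨ m = 3))
    (h10 : R 1 0) (h01 : R 0 1)
    (hx : ∀ a b, R a b → R (m * b - a) b) (hy : ∀ a b, R a b → R a (n * a - b))
    (hsign : ∀ a b, R a b → (0 ≤ a ∧ 0 ≤ b) ∨ (a ≤ 0 ∧ b ≤ 0))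
    (ha : ∀ a, R a 0 → a = 1 ∨ a = -1) (hb : ∀ b, R 0 b → b = 1 ∨ b = -1) :
    ∃ L : Finset (ℤ × ℤ), IsGradedChain L ∧
      ∀ a b, (a, b) ∈ L ↔ 0 ≤ a ∧ 0 ≤ b ∧ R a b := by
  -- `m` and `n` are the negated Cartan integers: the cases are A₁ × A₁, then A₂, B₂, G₂ for `m` =
  -- 1, 2, 3.
  obtain ⟨rfl, rfl⟩ | ⟨rfl, hm⟩ := hmn
  · refine ⟨{(1, 0), (0, 1)}, by unfold IsGradedChain; decide, fun a b ↦ ?_⟩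
    simp only [Finset.mem_insert, Finset.mem_singleton, Prod.mk.injEq]
    constructor
    · rintro (⟨rfl, rfl⟩ | ⟨rfl, rfl⟩) <;> simpa
    · rintro ⟨ha0, hb0, hab⟩
      have h1 := hsign _ _ (hy a b hab)
      have h2 : a = 0 ∨ b = 0 := by lia
      rcases h2 with rfl | rfl
      · have := hb b hab; lia
      · have := ha a hab; lia
  · have h11 : R 1 1 := by simpa using hy 1 0 h10
    have hm1 : R m 1 := by simpa using hx 0 1 h01
    -- Reflect alternately in the two simple roots. A vanishing coordinate determines the vector by
    -- `ha` or `hb`; otherwise `hsign` yields a further inequality, and these soon become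
    -- contradictory.
    have classify : ∀ a b, 0 ≤ a → 0 ≤ b → R a b → (a = 1 ∧ b = 0) ∨ (a = 0 ∧ b = 1) ∨
        (a = 1 ∧ b = 1) ∨ (a = m ∧ b = 1) ∨ (m = 3 ∧ a = 2 ∧ b = 1) ∨
        (m = 3 ∧ a = 3 ∧ b = 2) := by
      intro a b ha0 hb0 hab
      rcases eq_or_ne b 0 with rfl | hb1
      · have := ha a hab; lia
      rcases eq_or_ne a 0 with rfl | ha1
      · have := hb b hab; lia
      have ry : R a (a - b) := by simpa using hy a b hab
      have s1 := hsign _ _ ry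
      rcases eq_or_ne a b with rfl | hne
      · rw [sub_self] at ry
        have := ha a ry; lia
      have rx := hx a b hab
      have s2 := hsign _ _ rx
      rcases eq_or_ne (m * b - a) 0 with h0 | h0
      · rw [h0] at rx
        have : b = 1 := by have := hb b rx; lia
        subst this; lia
      have ryx : R (m * b - a) (m * b - a - b) := by simpa using hy _ _ rx
      have s3 := hsign _ _ ryx
      rcases eq_or_ne (m * b - a - b) 0 with h3 | h3
      · rw [h3] at ryx
        have h4 := ha _ ryx
        have : b = 1 := by lia
        subst this; lia
      obtain rfl : m = 3 := by rcases hm with rfl | rfl | rfl <;> lia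
      have rxy : R (2 * a - 3 * b) (a - b) := by convert hx _ _ ry using 1; ring
      have s4 := hsign _ _ rxy
      rcases eq_or_ne (2 * a - 3 * b) 0 with h4 | h4
      · rw [h4] at rxy
        have := hb _ rxy; lia
      have ryxy : R (2 * a - 3 * b) (a - 2 * b) := by convert hy _ _ rxy using 1; ring
      have s5 := hsign _ _ ryxy
      lia
    rcases hm with rfl | rfl | rfl
    · refine ⟨{(1, 0), (0, 1), (1, 1)}, by unfold IsGradedChain; decide, fun a b ↦ ?_⟩
      simp only [Finset.mem_insert, Finset.mem_singleton, Prod.mk.injEq]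
      constructor
      · rintro (⟨rfl, rfl⟩ | ⟨rfl, rfl⟩ | ⟨rfl, rfl⟩) <;> simpa
      · rintro ⟨h1, h2, h3⟩
        have := classify a b h1 h2 h3; lia
    · refine ⟨{(1, 0), (0, 1), (1, 1), (2, 1)}, by unfold IsGradedChain; decide, fun a b ↦ ?_⟩
      simp only [Finset.mem_insert, Finset.mem_singleton, Prod.mk.injEq]
      constructor
      · rintro (⟨rfl, rfl⟩ | ⟨rfl, rfl⟩ | ⟨rfl, rfl⟩ | ⟨rfl, rfl⟩) <;> simpa
      · rintro ⟨h1, h2, h3⟩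
        have := classify a b h1 h2 h3; lia
    · have h21 : R 2 1 := by simpa using hx 1 1 h11
      have h32 : R 3 2 := by simpa using hy 3 1 hm1
      refine ⟨{(1, 0), (0, 1), (1, 1), (2, 1), (3, 1), (3, 2)},
        by unfold IsGradedChain; decide, fun a b ↦ ?_⟩
      simp only [Finset.mem_insert, Finset.mem_singleton, Prod.mk.injEq]
      constructor
      · rintro (⟨rfl, rfl⟩ | ⟨rfl, rfl⟩ | ⟨rfl, rfl⟩ | ⟨rfl, rfl⟩ | ⟨rfl, rfl⟩ | ⟨rfl, rfl⟩) <;>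
          simpa
      · rintro ⟨h1, h2, h3⟩
        have := classify a b h1 h2 h3; lia

namespace RootPairing

namespace Base

variable {ι R M N : Type*} [CommRing R] [CharZero R] [IsDomain R] [AddCommGroup M] [Module R M]
  [AddCommGroup N] [Module R N] {P : RootPairing ι R M N} {b : P.Base}
  [Finite ι] [P.IsCrystallographic] [P.IsReduced]

omit [Finite ι] [P.IsCrystallographic] [P.IsReduced] [IsDomain R] in
lemma height_eq_add_of_support_eq_pair [DecidableEq ι] {x y : ι} (hxy : x ≠ y)
    (hb : b.support = {x, y})
    {i : ι} {a c : ℤ} (h : P.root i = a • P.root x + c • P.root y) : b.height i = a + c := by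
  have h' : P.root i = ∑ j ∈ b.support, (if j = x then a else c) • P.root j := by
    rw [hb, Finset.sum_pair hxy]; simpa [hxy.symm] using h
  rw [height_eq_sum h', hb, Finset.sum_pair hxy]
  simp [hxy.symm]

omit [Finite ι] [P.IsCrystallographic] [P.IsReduced] [IsDomain R] in
lemma IsPos.exists_root_eq_of_support_eq_pair [DecidableEq ι] {x y : ι} (hxy : x ≠ y)
    (hb : b.support = {x, y}) {i : ι} (hi : b.IsPos i) :
    ∃ a c : ℕ, P.root i = a • P.root x + c • P.root y := by
  obtain ⟨f, hf⟩ := hi.exists_root_eq_sum_nat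
  exact ⟨f x, f y, by rw [hf, hb, Finset.sum_pair hxy]⟩

/-- In a rank two root system, a positive root of height `h > 1` dominates all positive roots of at
most the same height, and there are exactly `h` positive roots of smaller height. -/
lemma IsPos.sub_mem_closure_and_ncard_eq_height [DecidableEq ι] {x y : ι} (hxy : x ≠ y)
    (hb : b.support = {x, y}) {i : ι} (hi : b.IsPos i) (hi1 : 1 < b.height i) :
    (∀ j, b.IsPos j → b.height j ≤ b.height i →
      P.root i - P.root j ∈ AddSubmonoid.closure (P.root '' b.support)) ∧
    ({j | b.IsPos j ∧ b.height j < b.height i}.ncard : ℤ) = b.height i := by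
  have : Module.IsReflexive R M := .of_isPerfPair P.toLinearMap
  have : Module.IsReflexive R N := .of_isPerfPair P.flip.toLinearMap
  have : IsAddTorsionFree M := .of_isTorsionFree R M
  have : IsAddTorsionFree N := .of_isTorsionFree R N
  have hx : x ∈ b.support := by simp [hb]
  have hy : y ∈ b.support := by simp [hb]
  -- Of two Cartan integers of distinct simple roots, one is 0 or -1; swapping `x` and `y` puts it
  -- in this position.
  wlog hn : P.pairingIn ℤ x y = 0 ∨ P.pairingIn ℤ x y = -1 generalizing x y
  · refine this hxy.symm (by rw [hb, Finset.pair_comm]) hy hx ?_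
    have h1 := P.pairingIn_pairingIn_mem_set_of_isCrystal_of_isRed x y
    have h2 := b.pairingIn_le_zero_of_ne hxy hx hy
    have h3 : ¬ (P.pairingIn ℤ x y = -2 ∧ P.pairingIn ℤ y x = -2) := by
      rw [P.pairingIn_neg_two_neg_two_iff]
      exact b.root_ne_neg_of_ne hx hy hxy
    simp only [Set.mem_insert_iff, Set.mem_singleton_iff, Prod.mk.injEq] at h1
    omega
  set e : ℤ → ℤ → M := fun a c ↦ a • P.root x + c • P.root y with he
  have hinj : ∀ a c a' c', e a c = e a' c' → a = a' ∧ c = c' := by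
    intro a c a' c' h
    have hli : LinearIndependent R ![P.root x, P.root y] :=
      b.linearIndependent_pair_of_ne (i := ⟨x, hx⟩) (j := ⟨y, hy⟩) (by simpa using hxy)
    have hli' := LinearIndependent.pair_iff.mp (hli.restrict_scalars' ℤ)
    have := hli' (a - a') (c - c') (by
      have : e a c - e a' c' = 0 := sub_eq_zero.mpr h
      rw [← this]; simp only [he]; module)
    omega
  have hrx : ∀ a c, e a c ∈ Set.range P.root →
      e (-P.pairingIn ℤ y x * c - a) c ∈ Set.range P.root := by
    rintro a c ⟨j, hj⟩
    refine ⟨P.reflectionPerm x j, ?_⟩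
    rw [root_reflectionPerm, hj]
    simp only [he, map_add, map_zsmul, reflection_apply_root' ℤ, pairingIn_same]
    module
  have hry : ∀ a c, e a c ∈ Set.range P.root →
      e a (-P.pairingIn ℤ x y * a - c) ∈ Set.range P.root := by
    rintro a c ⟨j, hj⟩
    refine ⟨P.reflectionPerm y j, ?_⟩
    rw [root_reflectionPerm, hj]
    simp only [he, map_add, map_zsmul, reflection_apply_root' ℤ, pairingIn_same]
    module
  have hsign : ∀ a c, e a c ∈ Set.range P.root → (0 ≤ a ∧ 0 ≤ c) ∨ (a ≤ 0 ∧ c ≤ 0) := by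
    rintro a c ⟨j, hj⟩
    obtain ⟨f, -, hf | hf⟩ := b.exists_root_eq_sum_nat_or_neg j <;>
    rw [hb, Finset.sum_pair hxy, hj] at hf
    · have := hinj a c (f x) (f y) (by rw [hf]; simp [he])
      omega
    · have := hinj a c (-f x) (-f y) (by rw [hf]; simp [he]; abel)
      omega
  have hmn : -P.pairingIn ℤ y x = 0 ∧ -P.pairingIn ℤ x y = 0 ∨ -P.pairingIn ℤ x y = 1 ∧
      (-P.pairingIn ℤ y x = 1 ∨ -P.pairingIn ℤ y x = 2 ∨ -P.pairingIn ℤ y x = 3) := by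
    have h1 := P.pairingIn_pairingIn_mem_set_of_isCrystal_of_isRed x y
    simp only [Set.mem_insert_iff, Set.mem_singleton_iff, Prod.mk.injEq] at h1
    omega
  obtain ⟨L, hL, hmem⟩ := exists_isGradedChain (fun a c ↦ e a c ∈ Set.range P.root) hmn
    ⟨x, by simp [he]⟩ ⟨y, by simp [he]⟩ hrx hry hsign
    (fun a h ↦ by
      have := b.eq_one_or_neg_one_of_mem_support_of_smul_mem x hx (a : R)
        (by simpa [he, Int.cast_smul_eq_zsmul] using h)
      exact_mod_cast this)
    (fun a h ↦ by
      have := b.eq_one_or_neg_one_of_mem_support_of_smul_mem y hy (a : R)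
        (by simpa [he, Int.cast_smul_eq_zsmul] using h)
      exact_mod_cast this)
  have coord : ∀ j, b.IsPos j → ∃ p ∈ L, P.root j = e p.1 p.2 ∧ b.height j = p.1 + p.2 := by
    intro j hj
    obtain ⟨a, c, h⟩ := hj.exists_root_eq_of_support_eq_pair hxy hb
    have h' : P.root j = (a : ℤ) • P.root x + (c : ℤ) • P.root y := by simpa using h
    exact ⟨(a, c), (hmem _ _).mpr ⟨by positivity, by positivity, j, h'⟩, h',
      height_eq_add_of_support_eq_pair hxy hb h'⟩
  obtain ⟨p, hp, hip, hih⟩ := coord i hi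
  obtain ⟨hcard, hdom⟩ := hL p hp (hih ▸ hi1)
  constructor
  · intro j hj hji
    obtain ⟨q, hq, hjq, hjh⟩ := coord j hj
    obtain ⟨h1, h2⟩ := hdom q hq (by omega)
    obtain ⟨u, hu⟩ := Int.eq_ofNat_of_zero_le (sub_nonneg.mpr h1)
    obtain ⟨v, hv⟩ := Int.eq_ofNat_of_zero_le (sub_nonneg.mpr h2)
    have : P.root i - P.root j = u • P.root x + v • P.root y := by
      rw [hip, hjq, ← natCast_zsmul, ← natCast_zsmul, ← hu, ← hv]; simp only [he]; module
    rw [this]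
    exact add_mem (AddSubmonoid.nsmul_mem _ (AddSubmonoid.subset_closure (Set.mem_image_of_mem _ hx)) _)
      (AddSubmonoid.nsmul_mem _ (AddSubmonoid.subset_closure (Set.mem_image_of_mem _ hy)) _)
  · suffices h : {j | b.IsPos j ∧ b.height j < b.height i}.ncard =
        (L.filter fun q ↦ q.1 + q.2 < p.1 + p.2).card by rw [h, hcard, hih]
    rw [← Set.ncard_coe_finset, ← Set.ncard_image_of_injective _ P.root.injective,
      ← Set.InjOn.ncard_image (f := fun q : ℤ × ℤ ↦ e q.1 q.2)
        (fun q _ r _ h ↦ Prod.ext_iff.mpr (hinj _ _ _ _ h))]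
    congr 1
    ext v
    simp only [Set.mem_image, Set.mem_ofPred_eq, Finset.coe_filter]
    constructor
    · rintro ⟨j, ⟨hj, hjlt⟩, rfl⟩
      obtain ⟨q, hq, hjq, hjh⟩ := coord j hj
      exact ⟨q, ⟨hq, by omega⟩, hjq.symm⟩
    · rintro ⟨q, ⟨hq, hlt⟩, rfl⟩
      obtain ⟨h1, h2, j, hj⟩ := (hmem q.1 q.2).mp hq
      have hjh := height_eq_add_of_support_eq_pair hxy hb hj
      exact ⟨j, ⟨b.isPos_iff'.mpr (by omega), by omega⟩, hj⟩

end Base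

/-! ### Root subsystems on subspaces. -/

section Subsystem

variable {ι K V W : Type*} [Field K] [CharZero K]
  [AddCommGroup V] [Module K V] [AddCommGroup W] [Module K W] [Finite ι]
  (P : RootPairing ι K V W)

/-- The root system formed by the roots lying in a subspace which they span. -/
noncomputable def subsystem (U : Submodule K V) [FiniteDimensional K U]
    (hU : Submodule.span K (P.root '' {i | P.root i ∈ U}) = U) :
    RootPairing {i // P.root i ∈ U} K U (Module.Dual K U) :=
  .mk'' (Module.Dual.eval K U)
    ⟨fun i ↦ ⟨P.root i, i.2⟩, fun i j h ↦ by simpa [Subtype.ext_iff] using h⟩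
    -- Restriction to `U` keeps coroots distinct: equal restrictions force both mutual pairings to
    -- be 2, hence equal roots.
    ⟨fun i ↦ P.coroot' i ∘ₗ U.subtype, fun i j h ↦ by
      have h1 := LinearMap.congr_fun h ⟨P.root i, i.2⟩
      have h2 := LinearMap.congr_fun h ⟨P.root j, j.2⟩
      simp only [LinearMap.comp_apply, Submodule.subtype_apply, root_coroot'_eq_pairing,
        pairing_same] at h1 h2
      exact Subtype.ext <| (P.pairing_two_two_iff i j).mp ⟨h1.symm, h2⟩⟩
    (fun i ↦ P.root_coroot_two i)
    (by
      rintro i - ⟨j, rfl⟩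
      have h : P.root (P.reflectionPerm i j) = P.root j - P.pairing j i • P.root i := by
        rw [root_reflectionPerm, reflection_apply_root]
      refine ⟨⟨P.reflectionPerm i j, h ▸ U.sub_mem j.2 (U.smul_mem _ i.2)⟩, Subtype.ext ?_⟩
      exact h)
    (by
      apply Submodule.map_injective_of_injective U.subtype_injective
      rw [Submodule.map_span, Submodule.map_subtype_top, ← Set.range_comp]
      conv_rhs => rw [← hU]
      congr 1
      ext v
      exact ⟨fun ⟨i, hi⟩ ↦ ⟨i, i.2, hi⟩, fun ⟨i, hi, h⟩ ↦ ⟨⟨i, hi⟩, h⟩⟩)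

variable (U : Submodule K V) [FiniteDimensional K U]
    (hU : Submodule.span K (P.root '' {i | P.root i ∈ U}) = U)

@[simp] lemma subsystem_pairing (i j : {i // P.root i ∈ U}) :
    (P.subsystem U hU).pairing i j = P.pairing i j := rfl

instance subsystem_isCrystallographic [P.IsCrystallographic] :
    (P.subsystem U hU).IsCrystallographic where
  exists_value i j := by simpa using P.exists_value (S := ℤ) i j

lemma subsystem_pairingIn [P.IsCrystallographic] (i j : {i // P.root i ∈ U}) :
    (P.subsystem U hU).pairingIn ℤ i j = P.pairingIn ℤ i j := by
  apply FaithfulSMul.algebraMap_injective ℤ K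
  simp only [algebraMap_pairingIn, subsystem_pairing]

instance subsystem_isRootSystem [P.IsCrystallographic] : (P.subsystem U hU).IsRootSystem :=
  isRootSystem_mk'' fun i j ↦ P.exists_value (S := ℤ) i j

instance subsystem_isReduced [P.IsReduced] : (P.subsystem U hU).IsReduced where
  eq_or_eq_neg i j h := by
    have : ¬ LinearIndependent K ![P.root i, P.root j] := by
      contrapose h
      apply LinearIndependent.of_comp U.subtype
      convert h using 1
      ext k
      fin_cases k <;> rfl
    rcases IsReduced.eq_or_eq_neg (P := P) i j this with h | h
    · exact .inl (Subtype.ext h)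
    · exact .inr (Subtype.ext h)

end Subsystem

end RootPairing

/-! ### From planes to the whole root system. -/

namespace RootPairing

namespace Base

section

variable {ι K V W : Type*} [Field K] [LinearOrder K] [IsStrictOrderedRing K]
  [AddCommGroup V] [Module K V] [AddCommGroup W] [Module K W] [Finite ι]
  {P : RootPairing ι K V W} {b : P.Base}

-- Turns domination in the root poset into strict inequality of `H`. It is applied to a plane's own
-- base, with `H` the restricted global height.
omit [Finite ι] in
lemma eq_zero_or_pos_of_mem_closure {H : V →ₗ[K] K} (hH : ∀ i, 0 < H (P.root i) ↔ b.IsPos i)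
    {v : V} (hv : v ∈ AddSubmonoid.closure (P.root '' b.support)) : v = 0 ∨ 0 < H v := by
  induction hv using AddSubmonoid.closure_induction with
  | mem x hx =>
    obtain ⟨i, hi, rfl⟩ := hx
    exact .inr ((hH i).mpr (isPos_of_mem_support hi))
  | zero => exact .inl rfl
  | add x y _ _ hx hy =>
    rcases hx with rfl | hx
    · simpa using hy
    · rcases hy with rfl | hy
      · simpa using Or.inr hx
      · rw [map_add]; exact .inr (add_pos hx hy)

variable [P.IsRootSystem] [P.IsCrystallographic] [P.IsReduced]

set_option maxHeartbeats 1000000 in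
/-- Local-to-global comparison of heights: for a plane spanned by the positive roots `α` and `β`,
the pairings of `α` with the other positive roots of the plane add up to twice the number of those
of them which have smaller height than `α` and precede it, minus one. -/
lemma sum_pairingIn_of_mem_span_pair [Fintype ι] {α β : ι} (hα : b.IsPos α) (hβ : b.IsPos β)
    (hβα : β ≠ α) (I : ι → Prop)
    (hI : ∀ i, b.IsPos i → b.height i < b.height α →
      P.root α - P.root i ∈ AddSubmonoid.closure (P.root '' b.support) → I i)
    (S T : Finset ι)
    (hS : ∀ j, j ∈ S ↔ b.IsPos j ∧ j ≠ α ∧ P.root j ∈ Submodule.span K {P.root α, P.root β})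
    (hT : ∀ j, j ∈ T ↔ j ∈ S ∧ I j ∧ b.height j < b.height α) :
    ∑ j ∈ S, P.pairingIn ℤ α j = 2 * ((T.card - 1 : ℕ) : ℤ) := by
  classical
  set U := Submodule.span K {P.root α, P.root β} with hUdef
  have hαU : P.root α ∈ U := Submodule.subset_span (by simp)
  have hβU : P.root β ∈ U := Submodule.subset_span (by simp)
  have : FiniteDimensional K U := FiniteDimensional.span_of_finite K (by simp)
  have hU : Submodule.span K (P.root '' {i | P.root i ∈ U}) = U := by
    apply le_antisymm
    · rw [Submodule.span_le]
      rintro - ⟨i, hi, rfl⟩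
      exact hi
    · conv_lhs => rw [hUdef]
      apply Submodule.span_mono
      rintro v (rfl | rfl)
      · exact ⟨α, hαU, rfl⟩
      · exact ⟨β, hβU, rfl⟩
  obtain ⟨H, hH⟩ := b.exists_linearMap_apply_root_eq_height
  have hHpos (i : ι) : 0 < H (P.root i) ↔ b.IsPos i := by rw [hH, isPos_iff]; exact Int.cast_pos
  let Q := P.subsystem U hU
  -- The global height functional selects the plane's base, so that positivity in the plane agrees
  -- with global positivity.
  obtain ⟨c, hc⟩ := Q.exists_base_forall_isPos_iff (H ∘ₗ U.subtype) (fun i ↦ by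
    change H (P.root i) ≠ 0
    rw [hH]
    exact_mod_cast b.height_ne_zero i)
  replace hc (i : {i // P.root i ∈ U}) : c.IsPos i ↔ b.IsPos i :=
    (hc i).trans (hHpos i)
  have hcl {v : U} (hv : v ∈ AddSubmonoid.closure (Q.root '' c.support)) :
      v = 0 ∨ 0 < H v :=
    eq_zero_or_pos_of_mem_closure (P := Q) (b := c) (H := H ∘ₗ U.subtype) (fun i ↦ (hHpos i).trans (hc i).symm) hv
  have hcl' {v : U} (hv : v ∈ AddSubmonoid.closure (Q.root '' c.support)) :
      (v : V) ∈ AddSubmonoid.closure (P.root '' b.support) := by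
    induction hv using AddSubmonoid.closure_induction with
    | mem x hx =>
      obtain ⟨i, hi, rfl⟩ := hx
      exact ((hc i).mp (isPos_of_mem_support hi)).root_mem_closure
    | zero => exact zero_mem _
    | add x y _ _ hx hy => exact add_mem hx hy
  let α' : {i // P.root i ∈ U} := ⟨α, hαU⟩
  have hα' : c.IsPos α' := (hc α').mpr hα
  have hrank : c.support.card = 2 := by
    have h1 := Module.finrank_eq_card_basis c.toWeightBasis
    rw [Fintype.card_coe] at h1
    rw [← h1]
    have hli : LinearIndependent K ![P.root α, P.root β] := hα.linearIndependent hβ hβα.symm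
    have := finrank_span_eq_card hli
    rw [Matrix.range_cons, Matrix.range_cons, Matrix.range_empty, Set.union_empty,
      Set.singleton_union] at this
    simpa using this
  have hsum : ∑ j ∈ S, P.pairingIn ℤ α j = 2 * (c.height α' - 1) := by
    have h1 := c.sum_pairingIn_isPos α'
    have h2 : α' ∈ Finset.univ.filter c.IsPos := by simpa using hα'
    rw [← Finset.add_sum_erase _ _ h2, pairingIn_same] at h1
    have h3 : ∑ j ∈ S, P.pairingIn ℤ α j =
        ∑ j ∈ (Finset.univ.filter c.IsPos).erase α', Q.pairingIn ℤ α' j := by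
      refine (Finset.sum_bij (fun j _ ↦ j.1) ?_ ?_ ?_ ?_).symm
      · intro j hj
        simp only [Finset.mem_erase, Finset.mem_filter, Finset.mem_univ, true_and] at hj
        exact (hS j).mpr ⟨(hc j).mp hj.2, fun h ↦ hj.1 (Subtype.ext h), j.2⟩
      · exact fun _ _ _ _ h ↦ Subtype.ext h
      · intro j hj
        obtain ⟨h4, h5, h6⟩ := (hS j).mp hj
        refine ⟨⟨j, h6⟩, ?_, rfl⟩
        simp only [Finset.mem_erase, Finset.mem_filter, Finset.mem_univ, true_and]
        exact ⟨fun h ↦ h5 (congrArg Subtype.val h), (hc _).mpr h4⟩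
      · exact fun j _ ↦ P.subsystem_pairingIn U hU α' j
    rw [h3]
    linarith
  -- If `α` is simple in the plane, the sum is 0. A positive root of the plane involving `α` is at
  -- least as high as `α`, so only the other simple root can lie in `T`. Truncated subtraction
  -- covers the case of empty `T`.
  by_cases hsimple : α' ∈ c.support
  · have hT1 : T.card ≤ 1 := by
      obtain ⟨y, hy⟩ := Finset.card_eq_one.mp
        (show (c.support.erase α').card = 1 by rw [Finset.card_erase_of_mem hsimple, hrank])
      have hyα : α' ≠ y := by
        have h := Finset.mem_singleton_self y
        rw [← hy] at h
        exact (Finset.ne_of_mem_erase h).symm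
      have hsupp : c.support = {α', y} := by rw [← Finset.insert_erase hsimple, hy]
      have hys : y ∈ c.support := by simp [hsupp]
      have hypos := (hc y).mp (isPos_of_mem_support hys)
      suffices T ⊆ {y.1} from (Finset.card_le_card this).trans (by simp)
      intro j hj
      obtain ⟨hjS, -, hlt⟩ := (hT j).mp hj
      obtain ⟨hjp, hjα, hjU⟩ := (hS j).mp hjS
      let j' : {i // P.root i ∈ U} := ⟨j, hjU⟩
      obtain ⟨u, v, huv⟩ := ((hc j').mpr hjp).exists_root_eq_of_support_eq_pair hyα hsupp
      replace huv : P.root j = u • P.root α + v • P.root y.1 := congrArg Subtype.val huv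
      have hu : u = 0 := by
        by_contra hu
        have h1 : b.height j = u * b.height α + v * b.height y.1 := by
          have := congrArg H huv
          simp only [map_add, map_nsmul, hH, nsmul_eq_mul] at this
          exact_mod_cast this
        have h2 : (1 : ℤ) ≤ u := by exact_mod_cast Nat.one_le_iff_ne_zero.mpr hu
        have h3 : 0 ≤ (v : ℤ) * b.height y.1 := mul_nonneg (by positivity) (le_of_lt hypos)
        have h4 : b.height α ≤ u * b.height α := le_mul_of_one_le_left (le_of_lt hα) h2
        omega
      rw [hu, zero_smul, zero_add] at huv
      have h1 : ¬ LinearIndependent K ![P.root j, P.root y.1] := by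
        rw [LinearIndependent.pair_iff]
        push Not
        exact ⟨1, -(v : K), by simp [huv, Nat.cast_smul_eq_nsmul], by simp⟩
      rw [Finset.mem_singleton]
      by_contra h2
      exact h1 (hjp.linearIndependent hypos h2)
    rw [hsum, height_one_of_mem_support hsimple, Nat.sub_eq_zero_of_le hT1]
    simp
  · obtain ⟨x, y, hxy, hsupp⟩ := Finset.card_eq_two.mp hrank
    have hht : 1 < c.height α' := by
      by_contra h1
      obtain ⟨u, v, huv⟩ := hα'.exists_root_eq_of_support_eq_pair hxy hsupp
      have h2 := height_eq_add_of_support_eq_pair hxy hsupp (i := α') (a := u) (c := v)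
        (by simpa using huv)
      have h3 : 0 < c.height α' := hα'
      have h4 : (u = 1 ∧ v = 0) ∨ (u = 0 ∧ v = 1) := by omega
      apply hsimple
      rcases h4 with ⟨rfl, rfl⟩ | ⟨rfl, rfl⟩
      · have : α' = x := Q.root.injective (by simpa using huv)
        simp [hsupp, this]
      · have : α' = y := Q.root.injective (by simpa using huv)
        simp [hsupp, this]
    obtain ⟨hdom, hcount⟩ := hα'.sub_mem_closure_and_ncard_eq_height hxy hsupp hht
    suffices hTc : (T.card : ℤ) = c.height α' by
      rw [hsum]
      omega
    -- Local and global heights may differ, but they compare with `α` alike: of `j` and `α`, the one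
    -- of larger local height dominates the other, hence is globally at least as high.
    have hlt_iff (j : {i // P.root i ∈ U}) (hj : c.IsPos j) :
        b.height j < b.height α ↔ c.height j < c.height α' := by
      have hHlt : b.height j < b.height α ↔ H (P.root j) < H (P.root α) := by
        rw [hH, hH, Int.cast_lt]
      rw [hHlt]
      constructor
      · intro h
        by_contra! h1
        have h2 := hcl ((hj.sub_mem_closure_and_ncard_eq_height hxy hsupp (by omega)).1 α' hα' h1)
        rcases h2 with h2 | h2
        · have h3 : P.root j - P.root α = 0 := congrArg Subtype.val h2
          rw [sub_eq_zero.mp h3] at h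
          exact lt_irrefl _ h
        · have h3 : 0 < H (P.root j - P.root α) := h2
          rw [map_sub] at h3
          linarith
      · intro h
        rcases hcl (hdom j hj h.le) with h2 | h2
        · have : α' = j := Q.root.injective (sub_eq_zero.mp h2)
          rw [this] at h
          omega
        · have h3 : 0 < H (P.root α - P.root j) := h2
          rw [map_sub] at h3
          linarith
    rw [← hcount, Nat.cast_inj, ← Set.ncard_coe_finset,
      ← Set.ncard_image_of_injective _ Subtype.val_injective]
    congr 1
    ext j
    simp only [Finset.mem_coe, Set.mem_image, Set.mem_ofPred_eq]
    constructor
    · intro hj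
      obtain ⟨hjS, -, hlt⟩ := (hT j).mp hj
      obtain ⟨hjp, hjα, hjU⟩ := (hS j).mp hjS
      have hjp' := (hc ⟨j, hjU⟩).mpr hjp
      exact ⟨⟨j, hjU⟩, ⟨hjp', (hlt_iff _ hjp').mp hlt⟩, rfl⟩
    · rintro ⟨j, ⟨hjp, hlt⟩, rfl⟩
      have hlt' := (hlt_iff j hjp).mpr hlt
      have hjp' := (hc j).mp hjp
      refine (hT _).mpr ⟨(hS _).mpr ⟨hjp', ?_, j.2⟩, hI _ hjp' hlt' (hcl' (hdom j hjp hlt.le)), hlt'⟩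
      intro h
      rw [h] at hlt'
      omega

end

end Base

end RootPairing

/-! ### Counting the planes through a root. -/

namespace RootPairing.Base

section

variable {ι K V W : Type*} [Field K] [CharZero K]
  [AddCommGroup V] [Module K V] [AddCommGroup W] [Module K W]
  {P : RootPairing ι K V W} {b : P.Base} [P.IsReduced]

lemma IsPos.root_notMem_span_singleton {i j : ι} (hi : b.IsPos i) (hj : b.IsPos j) (hij : i ≠ j) :
    P.root i ∉ Submodule.span K {P.root j} := by
  intro h
  obtain ⟨c, hc⟩ := Submodule.mem_span_singleton.mp h
  have := LinearIndependent.pair_iff.mp (hi.linearIndependent hj hij) 1 (-c) (by rw [← hc]; module)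
  exact one_ne_zero this.1

/-- An exchange argument, as `j` is not proportional to `α`. It identifies the fibres of the map
from roots to planes through `α`. -/
lemma IsPos.span_pair_eq_iff {α i j : ι} (hα : b.IsPos α) (hj : b.IsPos j) (hjα : j ≠ α) :
    Submodule.span K {P.root α, P.root j} = Submodule.span K {P.root α, P.root i} ↔
      P.root j ∈ Submodule.span K {P.root α, P.root i} := by
  refine ⟨fun h ↦ h ▸ Submodule.subset_span (by simp), fun h ↦ ?_⟩
  obtain ⟨u, v, huv⟩ := Submodule.mem_span_pair.mp h
  have hv : v ≠ 0 := by
    rintro rfl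
    refine hj.root_notMem_span_singleton hα hjα (Submodule.mem_span_singleton.mpr ⟨u, ?_⟩)
    rw [← huv]; simp
  apply le_antisymm <;> rw [Submodule.span_le] <;> rintro x (rfl | rfl)
  · exact Submodule.subset_span (by simp)
  · exact h
  · exact Submodule.subset_span (by simp)
  · refine Submodule.mem_span_pair.mpr ⟨-(v⁻¹ * u), v⁻¹, ?_⟩
    rw [← huv, smul_add, smul_smul, smul_smul, inv_mul_cancel₀ hv]
    module

end

section

variable {ι K V W : Type*} [Field K] [LinearOrder K] [IsStrictOrderedRing K]
  [AddCommGroup V] [Module K V] [AddCommGroup W] [Module K W] [Finite ι]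
  {P : RootPairing ι K V W} {b : P.Base} [P.IsRootSystem] [P.IsCrystallographic] [P.IsReduced]

/-- Let `F` consist of the roots of smaller height than a positive root `α` in a lower set of the
root poset containing `α`. The number of planes spanned by `α` and a root in `F` is `|F|` minus
one less than the height of `α`. -/
lemma card_eq_card_image_span_pair_add [DecidableEq (Submodule K V)] {α : ι} (hα : b.IsPos α)
    (I : ι → Prop) (hIpos : ∀ i, I i → b.IsPos i)
    (hI : ∀ i, b.IsPos i → b.height i < b.height α →
      P.root α - P.root i ∈ AddSubmonoid.closure (P.root '' b.support) → I i)
    (F : Finset ι) (hF : ∀ i, i ∈ F ↔ I i ∧ b.height i < b.height α) :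
    (F.card : ℤ) =
      (F.image fun i ↦ Submodule.span K {P.root α, P.root i}).card + (b.height α - 1) := by
  classical
  have : Fintype ι := Fintype.ofFinite ι
  set φ : ι → Submodule K V := fun i ↦ Submodule.span K {P.root α, P.root i} with hφ
  set S := (Finset.univ.filter b.IsPos).erase α with hS
  have hmemS (j : ι) : j ∈ S ↔ b.IsPos j ∧ j ≠ α := by
    simp [hS, and_comm]
  have hFS : F ⊆ S := by
    intro j hj
    obtain ⟨h1, h2⟩ := (hF j).mp hj
    exact (hmemS j).mpr ⟨hIpos j h1, by rintro rfl; exact lt_irrefl _ h2⟩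
  have hsum : ∑ j ∈ S, P.pairingIn ℤ α j = 2 * (b.height α - 1) := by
    have h1 := b.sum_pairingIn_isPos α
    have h2 : α ∈ Finset.univ.filter b.IsPos := by simpa using hα
    rw [← Finset.add_sum_erase _ _ h2, pairingIn_same] at h1
    linarith
  have hlocal : ∀ Y ∈ S.image φ, ∑ j ∈ S with φ j = Y, P.pairingIn ℤ α j =
      2 * (((F.filter fun j ↦ φ j = Y).card - 1 : ℕ) : ℤ) := by
    intro Y hY
    obtain ⟨β, hβ, rfl⟩ := Finset.mem_image.mp hY
    obtain ⟨hβp, hβα⟩ := (hmemS β).mp hβ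
    refine sum_pairingIn_of_mem_span_pair hα hβp hβα I hI _ _ (fun j ↦ ?_) (fun j ↦ ?_)
    · rw [Finset.mem_filter, hmemS, and_assoc]
      exact and_congr_right fun hj ↦ and_congr_right fun hjα ↦ hα.span_pair_eq_iff hj hjα
    · rw [Finset.mem_filter, Finset.mem_filter, hF]
      constructor
      · rintro ⟨h1, h2⟩
        exact ⟨⟨hFS ((hF j).mpr h1), h2⟩, h1⟩
      · rintro ⟨⟨-, h1⟩, h2⟩
        exact ⟨h2, h1⟩
  -- Planes missing `F` drop out because 0 - 1 is truncated to 0; on the others the fibre is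
  -- nonempty and the subtraction is genuine.
  rw [← Finset.sum_fiberwise_of_maps_to (t := S.image φ)
    (fun j hj ↦ Finset.mem_image_of_mem φ hj), Finset.sum_congr rfl hlocal, ← Finset.mul_sum,
    ← Finset.sum_subset (Finset.image_subset_image hFS)] at hsum
  · have hcard := Finset.card_eq_sum_card_image φ F
    have hpos : ∀ Y ∈ F.image φ, (((F.filter fun j ↦ φ j = Y).card - 1 : ℕ) : ℤ) =
        (F.filter fun j ↦ φ j = Y).card - 1 := by
      intro Y hY
      obtain ⟨β, hβ, rfl⟩ := Finset.mem_image.mp hY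
      have : 0 < (F.filter fun j ↦ φ j = φ β).card :=
        Finset.card_pos.mpr ⟨β, Finset.mem_filter.mpr ⟨hβ, rfl⟩⟩
      omega
    rw [Finset.sum_congr rfl hpos, Finset.sum_sub_distrib, ← Nat.cast_sum, ← hcard] at hsum
    simp only [Finset.sum_const, nsmul_eq_mul, mul_one] at hsum
    omega
  · intro Y _ hY
    have : (F.filter fun j ↦ φ j = Y) = ∅ := by
      rw [Finset.filter_eq_empty_iff]
      exact fun j hj h ↦ hY (h ▸ Finset.mem_image_of_mem φ hj)
    simp [this]

end

end RootPairing.Base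

/-! ### The arrangement statement. -/

theorem proposition4p5 {ι V N : Type*} [Finite ι]
    [NormedAddCommGroup V] [InnerProductSpace ℝ V] [AddCommGroup N] [Module ℝ N]
    (P : RootPairing ι ℝ V N) [P.IsCrystallographic] [P.IsReduced] [P.IsIrreducible]
    (hP : ∀ (i : ι) (x y : V), ⟪P.reflection i x, P.reflection i y⟫_ℝ = ⟪x, y⟫_ℝ)
    (b : P.Base) (I : Set ι) (hI : IdealArrangement.IsRootIdeal b I)
    (α : ι) (hα : α ∈ I) (k : ℕ) (hk : b.height α = (k : ℤ) + 1) (hk1 : 1 < b.height α)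
    (B' B B'' : Set (Submodule ℝ V))
    (hB' : B' = IdealArrangement.heightArrangement b I k)
    (hB : B = B' ∪ {IdealArrangement.rootHyperplane P α})
    (hB'' : B'' = IdealArrangement.restriction B (IdealArrangement.rootHyperplane P α)) :
    B'' = {Y | ∃ H ∈ B', Y = H ⊓ IdealArrangement.rootHyperplane P α} ∧
      (B'.ncard : ℤ) - (B''.ncard : ℤ) = (k : ℤ) := by
  classical
  have : Fintype ι := Fintype.ofFinite ι
  have : Nonempty ι := ⟨α⟩
  have : FiniteDimensional ℝ V := .of_basis b.toWeightBasis
  have hαpos : b.IsPos α := hI.isPos α hα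
  have hinj (X Y : Submodule ℝ V) (h : Xᗮ = Yᗮ) : X = Y := by
    rw [← X.orthogonal_orthogonal, h, Y.orthogonal_orthogonal]
  have hnotle (i j : ι) (hi : b.IsPos i) (hj : b.IsPos j) (hij : i ≠ j) :
      ¬ IdealArrangement.rootHyperplane P j ≤ IdealArrangement.rootHyperplane P i := by
    intro h
    have h' := Submodule.orthogonal_le h
    simp only [IdealArrangement.rootHyperplane, Submodule.orthogonal_orthogonal] at h'
    exact hi.root_notMem_span_singleton hj hij (h' (Submodule.mem_span_singleton_self _))
  let F : Finset ι := Finset.univ.filter fun i ↦ i ∈ I ∧ b.height i < b.height α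
  have hF (i : ι) : i ∈ F ↔ i ∈ I ∧ b.height i < b.height α := by simp [F]
  have hB'F : B' = IdealArrangement.rootHyperplane P '' F := by
    rw [hB']
    ext H
    constructor
    · rintro ⟨i, hi, hik, rfl⟩
      exact ⟨i, (hF i).mpr ⟨hi, by omega⟩, rfl⟩
    · rintro ⟨i, hi, rfl⟩
      obtain ⟨h1, h2⟩ := (hF i).mp hi
      exact ⟨i, h1, by omega, rfl⟩
  have hfirst : B'' = {Y | ∃ H ∈ B', Y = H ⊓ IdealArrangement.rootHyperplane P α} := by
    rw [hB'', hB]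
    ext Y
    constructor
    · rintro ⟨H, hH | rfl, hle, rfl⟩
      · exact ⟨H, hH, rfl⟩
      · exact absurd le_rfl hle
    · rintro ⟨H, hH, rfl⟩
      refine ⟨H, .inl hH, ?_, rfl⟩
      rw [hB'F] at hH
      obtain ⟨i, hi, rfl⟩ := hH
      obtain ⟨h1, h2⟩ := (hF i).mp hi
      exact hnotle i α (hI.isPos i h1) hαpos (by rintro rfl; exact lt_irrefl _ h2)
  refine ⟨hfirst, ?_⟩
  have hcard' : B'.ncard = F.card := by
    rw [hB'F, Set.InjOn.ncard_image, Set.ncard_coe_finset]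
    intro i hi j hj hij
    by_contra hne
    exact hnotle i j (hI.isPos i ((hF i).mp hi).1) (hI.isPos j ((hF j).mp hj).1) hne hij.ge
  have hcard'' : B''.ncard =
      (F.image fun i ↦ Submodule.span ℝ {P.root α, P.root i}).card := by
    -- H_β ∩ H_α is the orthogonal complement of the plane spanned by the two roots, and in finite
    -- dimension complements determine the planes.
    have : B'' = (fun X : Submodule ℝ V ↦ Xᗮ) ''
        (F.image fun i ↦ Submodule.span ℝ {P.root α, P.root i} : Finset (Submodule ℝ V)) := by
      rw [hfirst, hB'F, Finset.coe_image, Set.image_image]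
      ext Y
      have key (i : ι) : IdealArrangement.rootHyperplane P i ⊓
          IdealArrangement.rootHyperplane P α = (Submodule.span ℝ {P.root α, P.root i})ᗮ := by
        rw [IdealArrangement.rootHyperplane, IdealArrangement.rootHyperplane,
          Submodule.inf_orthogonal, ← Submodule.span_union, Set.singleton_union, Set.pair_comm]
      constructor
      · rintro ⟨-, ⟨i, hi, rfl⟩, rfl⟩
        exact ⟨i, hi, (key i).symm⟩
      · rintro ⟨i, hi, rfl⟩
        exact ⟨_, ⟨i, hi, rfl⟩, (key i).symm⟩
    rw [this, Set.ncard_image_of_injective _ (fun X Y h ↦ hinj X Y h), Set.ncard_coe_finset]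
  have hmain := RootPairing.Base.card_eq_card_image_span_pair_add hαpos (· ∈ I) hI.isPos
    (fun i hi _ hle ↦ hI.mem_of_le α hα i hi hle) F hF
  rw [hcard', hcard'']
  omega
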